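/- All rings are commutative with identity. A ring $S$ is a valuation ring if its ideals are totally ordered by inclusion (zero divisors are allowed), and a ring $R$ is arithmetical if $R_P$ is a valuation ring for each maximal ideal $P$ of $R$. A ring $S$ is self FP-injective if $\mathrm{Ext}^1_S(F,S)=0$ for each finitely presented $S$-module $F$. A ring $R$ is finitely fractionally self FP-injective if, for each finitely generated ideal $A$ of $R$, the classical ring of quotients $Q(R/A)$ (the localization of $R/A$ at the set of all its regular elements) is self FP-injective. Proposition. There exists a ring $R$ of Krull dimension zero which is finitely fractionally self FP-injective but not arithmetical. -/

import Mathlib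

universe u v

/-- A module is uniserial if its submodules are totally ordered by inclusion. -/
def IsUniserial (R : Type u) [CommRing R] (M : Type v) [AddCommGroup M] [Module R M] : Prop :=
  ∀ N N' : Submodule R M, N ≤ N' ∨ N' ≤ N

/-- A (not necessarily integral) valuation ring: a ring that is uniserial as a module over
itself. Mathlib's `ValuationRing` requires a domain. -/
def IsUniserialRing (R : Type u) [CommRing R] : Prop :=
  IsUniserial R R

/-- A ring is arithmetical if its localization at every maximal ideal is a valuation ring
(possibly with zero divisors). -/
def IsArithmeticalRing (R : Type u) [CommRing R] : Prop :=
  ∀ (P : Ideal R) [P.IsMaximal], IsUniserialRing (Localization.AtPrime P)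

/-- An `R`-module `E` is FP-injective if `Ext¹_R(F, E) = 0` for every finitely presented
`R`-module `F`. -/
def IsFPInjective (R : Type u) [CommRing R] (E : Type u) [AddCommGroup E] [Module R E] : Prop :=
  ∀ (F : Type u) [AddCommGroup F] [Module R F], Module.FinitePresentation R F →
    Subsingleton (CategoryTheory.Abelian.Ext.{u} (ModuleCat.of R F) (ModuleCat.of R E) 1)

/-- A ring is self FP-injective if it is FP-injective as a module over itself. -/
def IsSelfFPInjective (R : Type u) [CommRing R] : Prop :=
  IsFPInjective R R

/-- For a property `Prp` of commutative rings, `R` is finitely fractionally `Prp` if, for every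
finitely generated ideal `A` of `R`, the classical ring of quotients of `R ⧸ A` (that is, its
localization at the set of all its regular elements) has the property `Prp`. -/
def IsFinitelyFractionally (Prp : ∀ (S : Type u) [CommRing S], Prop)
    (R : Type u) [CommRing R] : Prop :=
  ∀ A : Ideal R, A.FG → Prp (FractionRing (R ⧸ A))

/-!
The ring is a direct limit `R` of split local extensions in which every element is a unit or
nilpotent. Then `R ⧸ A` is its own classical ring of quotients for every ideal `A`, and it remains
to make `R ⧸ A` self FP-injective for `A` finitely generated.

A ring `S` is self FP-injective as soon as linear systems over `S` satisfy the Fredholm alternative: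
either `c g = s` has a solution `c`, or some vector `ψ` has `g ψ = 0` and `s ψ ≠ 0`
(`FredholmAlternative.isSelfFPInjective`). For `S = R ⧸ A` this concerns systems over `R` modulo
`A`. Certificates `ψ` can be adjoined freely: if a system of `m` equations over a ring `B` is not
solvable modulo `I`, let `N ≤ B ^ m` be generated by its rows and by `I ^ m`; in the trivial
extension of `B` by `B ^ m ⧸ N` the classes of the standard basis vectors form a certificate
(`adjoinsCertificates_inlHom`). Extending by the product of all quotients of finite free modules
serves all systems over `B` at once. Countably many iterations suffice, because finitely many
elements of the limit lie in one term; since each term is a retract of the limit, certificates are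
never destroyed (`SplitLimit.fredholmAlternative`).

The retractions also preserve non-divisibility. Starting from the trivial extension of a field by a
two-dimensional vector space, two basis vectors generate incomparable ideals of the limit, which is
local and hence not arithmetical.
-/

open CategoryTheory

/-! ### The Fredholm alternative and FP-injectivity -/

/-- The Fredholm alternative modulo an ideal `A`: a finite linear system `∑ i, c i * g i j = s j`
is either solvable modulo `A`, or its unsolvability is certified by a vector `ψ` that annihilates
every row of `g` modulo `A` but not the right-hand side `s`. -/
def FredholmAlternative {S : Type*} [CommRing S] (A : Ideal S) : Prop :=
  ∀ (k m : ℕ) (g : Fin k → Fin m → S) (s : Fin m → S),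
    (∃ c : Fin k → S, ∀ j, s j - ∑ i, c i * g i j ∈ A) ∨
      ∃ ψ : Fin m → S, (∀ i, ∑ j, g i j * ψ j ∈ A) ∧ ∑ j, s j * ψ j ∉ A

theorem FredholmAlternative.bot_of_surjective {R S : Type*} [CommRing R] [CommRing S]
    (π : R →+* S) (hπ : Function.Surjective π) (h : FredholmAlternative (RingHom.ker π)) :
    FredholmAlternative (⊥ : Ideal S) := by
  intro k m g s
  choose σ hσ using hπ
  rcases h k m (fun i j => σ (g i j)) (fun j => σ (s j)) with ⟨c, hc⟩ | ⟨ψ, h1, h2⟩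
  · refine .inl ⟨fun i => π (c i), fun j => ?_⟩
    simpa [RingHom.mem_ker, hσ] using hc j
  · refine .inr ⟨fun j => π (ψ j), fun i => ?_, ?_⟩
    · simpa [RingHom.mem_ker, hσ] using h1 i
    · simpa [RingHom.mem_ker, hσ] using h2

/-- The Fredholm alternative over `S` allows any linear form on a finitely generated submodule
of `S ^ n` to be extended to `S ^ n`: the values prescribed for the extension form a linear system,
and a certificate of unsolvability would be a relation between the generators that is not
respected by the form. -/
theorem FredholmAlternative.exists_extend {S : Type*} [CommRing S]
    (h : FredholmAlternative (⊥ : Ideal S)) {n : ℕ} (K : Submodule S (Fin n → S)) (hK : K.FG)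
    (f : K →ₗ[S] S) : ∃ F : (Fin n → S) →ₗ[S] S, F ∘ₗ K.subtype = f := by
  obtain ⟨k, g, hg⟩ := Submodule.fg_iff_exists_fin_generating_family.mp hK
  have hgK (i : Fin k) : g i ∈ K := hg ▸ Submodule.subset_span ⟨i, rfl⟩
  rcases h n k (fun j i => g i j) (fun i => f ⟨g i, hgK i⟩) with ⟨c, hc⟩ | ⟨ψ, h1, h2⟩
  · refine ⟨Fintype.linearCombination S c, ?_⟩
    have hspan : Submodule.span S (Set.range fun i => (⟨g i, hgK i⟩ : K)) = ⊤ := by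
      apply Submodule.map_injective_of_injective K.subtype_injective
      rw [Submodule.map_span, ← Set.range_comp, Submodule.map_top, Submodule.range_subtype]
      exact hg
    refine LinearMap.ext_on_range hspan fun i => ?_
    have := hc i
    rw [Ideal.mem_bot, sub_eq_zero] at this
    simp [Fintype.linearCombination_apply, this, mul_comm]
  · refine absurd ?_ h2
    have h0 : ∑ i, ψ i • (⟨g i, hgK i⟩ : K) = 0 := by
      ext j
      have := h1 j
      rw [Ideal.mem_bot] at this
      simpa [mul_comm] using this
    have := congrArg f h0
    rw [map_sum, map_zero] at this
    rw [Ideal.mem_bot, ← this]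
    exact Finset.sum_congr rfl fun i _ => by rw [map_smul, smul_eq_mul, mul_comm]

theorem FredholmAlternative.isSelfFPInjective {S : Type u} [CommRing S]
    (h : FredholmAlternative (⊥ : Ideal S)) : IsSelfFPInjective S := by
  intro F _ _ hF
  -- Every class in `Ext¹(F, S)` comes from a form on the kernel of a free presentation of `F`, and
  -- it vanishes because that form extends to the free module.
  obtain ⟨n, f, hf⟩ := Module.Finite.exists_fin' S F
  have hexact := LinearMap.shortExact_shortComplexKer hf
  refine subsingleton_of_forall_eq 0 fun e => ?_
  have : Projective (ModuleCat.of S (Fin n → S)) :=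
    ModuleCat.projective_of_free (Pi.basisFun S (Fin n))
  obtain ⟨x, rfl⟩ := Abelian.Ext.contravariant_sequence_exact₃ hexact _ e
    (Abelian.Ext.eq_zero_of_projective _) (add_zero 1)
  obtain ⟨x, rfl⟩ := Abelian.Ext.addEquiv₀.symm.surjective x
  obtain ⟨G, hG⟩ := h.exists_extend (LinearMap.ker f)
    (Module.FinitePresentation.fg_ker f hf) x.hom
  have hx : x = f.shortComplexKer.f ≫ ModuleCat.ofHom G := by
    ext1
    exact hG.symm
  change hexact.extClass.comp (Abelian.Ext.mk₀ x) _ = 0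
  rw [hx, ← Abelian.Ext.mk₀_comp_mk₀]
  exact hexact.extClass_comp_assoc _

/-! ### Rings whose elements are units or nilpotent -/

theorem ringKrullDim_eq_zero_of_isUnit_or_isNilpotent {R : Type*} [CommRing R] [Nontrivial R]
    (h : ∀ x : R, IsUnit x ∨ IsNilpotent x) : ringKrullDim R = 0 := by
  have := (((Ring.krullDimLE_zero_and_isLocalRing_tfae R).out 2 0 rfl rfl).mp fun x =>
    ⟨fun hx hu => hx.not_isUnit hu, (h x).resolve_left⟩).1
  exact ringKrullDimZero_iff_ringKrullDim_eq_zero.mp this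

/-- Regular elements of `R ⧸ A` are units, so that `R ⧸ A` is its own classical ring of
quotients. -/
theorem isFinitelyFractionally_isSelfFPInjective {R : Type u} [CommRing R]
    (h : ∀ x : R, IsUnit x ∨ IsNilpotent x)
    (hF : ∀ A : Ideal R, A.FG → FredholmAlternative A) :
    IsFinitelyFractionally.{u} (fun S _ => IsSelfFPInjective S) R := by
  intro A hA
  have hunit : nonZeroDivisors (R ⧸ A) ≤ IsUnit.submonoid (R ⧸ A) := by
    intro x hx
    obtain ⟨x, rfl⟩ := Ideal.Quotient.mk_surjective x
    rcases h x with hu | hn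
    · exact hu.map _
    · obtain ⟨k, hk⟩ := hn.map (Ideal.Quotient.mk A)
      have := pow_mem hx k
      rw [hk] at this
      have : Subsingleton (R ⧸ A) := subsingleton_of_forall_eq 0 fun y => this.1 y (zero_mul y)
      exact isUnit_of_subsingleton _
  let e := IsLocalization.atUnits (R ⧸ A) (nonZeroDivisors (R ⧸ A))
    (S := FractionRing (R ⧸ A)) hunit
  refine FredholmAlternative.isSelfFPInjective (.bot_of_surjective
    ((e : R ⧸ A →+* FractionRing (R ⧸ A)).comp (Ideal.Quotient.mk A))
    (e.surjective.comp Ideal.Quotient.mk_surjective) ?_)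
  convert hF A hA
  ext x
  simp [RingHom.mem_ker, Ideal.Quotient.eq_zero_iff_mem]

/-- Such a ring equals its localization at a maximal ideal, since the elements outside that ideal
are units. -/
theorem not_isArithmeticalRing {R : Type*} [CommRing R] [Nontrivial R]
    (h : ∀ x : R, IsUnit x ∨ IsNilpotent x) {x y : R} (hxy : ¬ x ∣ y) (hyx : ¬ y ∣ x) :
    ¬ IsArithmeticalRing R := by
  intro harith
  obtain ⟨P, hP⟩ := Ideal.exists_maximal R
  let e := IsLocalization.atUnits R P.primeCompl (S := Localization.AtPrime P) fun z hz =>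
    (h z).resolve_right fun ⟨k, hk⟩ => hz (hP.isPrime.mem_of_pow_mem k (hk ▸ P.zero_mem))
  rcases harith P (Ideal.span {e x}) (Ideal.span {e y}) with hle | hle
  · exact hyx ((map_dvd_iff e).mp (Ideal.span_singleton_le_span_singleton.mp hle))
  · exact hxy ((map_dvd_iff e).mp (Ideal.span_singleton_le_span_singleton.mp hle))

/-! ### Limits of sequences of split ring extensions -/

section SplitLimit

variable {T : ℕ → Type*} [∀ n, CommRing (T n)] (p : ∀ n, T (n + 1) →+* T n)
  (ι : ∀ n, T n →+* T (n + 1))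

/-- The threads of the inverse system `p` that follow the sections `ι` from the index `N` on. -/
def stableThreads (N : ℕ) : Subring (∀ n, T n) where
  carrier := {x | (∀ n, p n (x (n + 1)) = x n) ∧ ∀ n, N ≤ n → x (n + 1) = ι n (x n)}
  mul_mem' hx hy := ⟨fun n => by simp [hx.1, hy.1], fun n hn => by simp [hx.2 n hn, hy.2 n hn]⟩
  one_mem' := ⟨fun n => by simp, fun n _ => by simp⟩
  add_mem' hx hy := ⟨fun n => by simp [hx.1, hy.1], fun n hn => by simp [hx.2 n hn, hy.2 n hn]⟩
  zero_mem' := ⟨fun n => by simp, fun n _ => by simp⟩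
  neg_mem' hx := ⟨fun n => by simp [hx.1], fun n hn => by simp [hx.2 n hn]⟩

variable {p ι}

theorem stableThreads_mono : Monotone (stableThreads p ι) :=
  fun _ _ h _ hx => ⟨hx.1, fun n hn => hx.2 n (h.trans hn)⟩

/-- A thread that is stable from `N` on is determined by its value at `N`: lower terms are obtained
by the retractions, higher ones by the sections. -/
theorem stableThreads_ext {N : ℕ} {x y : ∀ n, T n} (hx : x ∈ stableThreads p ι N)
    (hy : y ∈ stableThreads p ι N) (h : x N = y N) : x = y := by
  funext n
  rcases le_total n N with hn | hn
  · induction hn using Nat.decreasingInduction with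
    | self => exact h
    | of_succ k _ ih => rw [← hx.1, ← hy.1, ih]
  · induction n, hn using Nat.le_induction with
    | base => exact h
    | succ k hk ih => rw [hx.2 k hk, hy.2 k hk, ih]

theorem exists_mem_stableThreads (hp : ∀ n x, p n (ι n x) = x) (N : ℕ) (a : T N) :
    ∃ x ∈ stableThreads p ι N, x N = a := by
  induction N with
  | zero =>
    exact ⟨fun n => Nat.rec a (fun k => ι k) n, ⟨fun n => hp n _, fun n _ => rfl⟩, rfl⟩
  | succ N ih =>
    obtain ⟨y, hy, hya⟩ := ih (p N a)
    -- The thread agrees with `y` up to `N`, takes the value `a` at `N + 1` and follows `ι` above.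
    let z : ∀ n, T n := fun n => Nat.rec (motive := T) (y 0)
      (fun k zk => if h : N = k then h ▸ a else if k < N then y (k + 1) else ι k zk) n
    have zsucc (k : ℕ) : z (k + 1) =
      if h : N = k then h ▸ a else if k < N then y (k + 1) else ι k (z k) := rfl
    have zlow (k : ℕ) (hk : k ≤ N) : z k = y k := by
      cases k with
      | zero => rfl
      | succ k => rw [zsucc, dif_neg (by omega), if_pos (by omega)]
    have zN : z (N + 1) = a := by rw [zsucc, dif_pos rfl]
    have zhigh (k : ℕ) (hk : N + 1 ≤ k) : z (k + 1) = ι k (z k) := by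
      rw [zsucc, dif_neg (by omega), if_neg (by omega)]
    refine ⟨z, ⟨fun n => ?_, zhigh⟩, zN⟩
    rcases lt_trichotomy n N with hn | rfl | hn
    · rw [zlow _ hn, zlow _ hn.le, hy.1]
    · rw [zN, zlow _ le_rfl, hya]
    · rw [zhigh _ hn, hp]

variable (p ι) in
/-- The direct limit of the sections `ι`, realized inside the inverse limit of the retractions
`p` as the ring of threads that eventually follow `ι`. In this model every term of the sequence is
visibly a retract of the limit. -/
def SplitLimit : Subring (∀ n, T n) := ⨆ N, stableThreads p ι N

namespace SplitLimit

theorem mem_iff {x : ∀ n, T n} : x ∈ SplitLimit p ι ↔ ∃ N, x ∈ stableThreads p ι N :=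
  Subring.mem_iSup_of_directed stableThreads_mono.directed_le

variable (p ι) in
/-- The projection of the limit to a term of the sequence. -/
def proj (N : ℕ) : SplitLimit p ι →+* T N := (Pi.evalRingHom T N).comp (SplitLimit p ι).subtype

theorem nontrivial (N : ℕ) [Nontrivial (T N)] : Nontrivial (SplitLimit p ι) :=
  (proj p ι N).domain_nontrivial

/-- The inclusion of a term of the sequence in the limit. -/
noncomputable def incl (hp : ∀ n x, p n (ι n x) = x) (N : ℕ) : T N →+* SplitLimit p ι :=
  (Subring.inclusion (le_iSup (stableThreads p ι) N)).comp
    (RingEquiv.ofBijective ((Pi.evalRingHom T N).comp (stableThreads p ι N).subtype)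
      ⟨fun x y h => Subtype.ext (stableThreads_ext x.2 y.2 h), fun a =>
        let ⟨x, hx, hxa⟩ := exists_mem_stableThreads hp N a
        ⟨⟨x, hx⟩, hxa⟩⟩).symm.toRingHom

variable (hp : ∀ n x, p n (ι n x) = x)

theorem incl_mem (N : ℕ) (a : T N) : (incl hp N a : ∀ n, T n) ∈ stableThreads p ι N :=
  Subtype.prop ((RingEquiv.ofBijective ((Pi.evalRingHom T N).comp (stableThreads p ι N).subtype)
    _).symm a)

@[simp]
theorem proj_incl (N : ℕ) (a : T N) : proj p ι N (incl hp N a) = a :=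
  RingEquiv.apply_symm_apply (RingEquiv.ofBijective
    ((Pi.evalRingHom T N).comp (stableThreads p ι N).subtype) _) a

theorem incl_proj {N : ℕ} {x : SplitLimit p ι} (hx : (x : ∀ n, T n) ∈ stableThreads p ι N) :
    incl hp N (proj p ι N x) = x :=
  Subtype.ext (stableThreads_ext (incl_mem hp N _) hx (proj_incl hp N _))

@[simp]
theorem proj_succ_incl (N : ℕ) (a : T N) : proj p ι (N + 1) (incl hp N a) = ι N a := by
  have := (incl_mem hp N a).2 N le_rfl
  exact this.trans (congrArg (ι N) (proj_incl hp N a))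

theorem incl_succ (N : ℕ) (a : T N) : incl hp (N + 1) (ι N a) = incl hp N a := by
  rw [← proj_succ_incl hp]
  exact incl_proj hp (stableThreads_mono N.le_succ (incl_mem hp N a))

/-- Finitely many elements of the limit come from a common term of the sequence. -/
theorem exists_incl_proj {α : Type*} [Finite α] (x : α → SplitLimit p ι) :
    ∃ N, ∀ a, incl hp N (proj p ι N (x a)) = x a := by
  choose M hM using fun a => mem_iff.mp (x a).2
  obtain ⟨N, hN⟩ := Finite.bddAbove_range M
  exact ⟨N, fun a => incl_proj hp (stableThreads_mono (hN ⟨a, rfl⟩) (hM a))⟩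

include hp in
theorem isUnit_or_isNilpotent (h : ∀ n (x : T n), IsUnit x ∨ IsNilpotent x)
    (x : SplitLimit p ι) : IsUnit x ∨ IsNilpotent x := by
  obtain ⟨N, hN⟩ := exists_incl_proj hp fun _ : Unit => x
  rw [← hN ()]
  exact (h N _).imp (·.map _) (·.map _)

theorem not_incl_dvd {N : ℕ} {a b : T N} (h : ¬ a ∣ b) : ¬ incl hp N a ∣ incl hp N b :=
  fun hd => h (by simpa using map_dvd (proj p ι N) hd)

end SplitLimit

end SplitLimit

/-- A ring homomorphism `ι : B → C` adjoins certificates of unsolvability if every finite linear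
system over `B` that is not solvable modulo an ideal `I` acquires in `C` a vector `ψ` that
annihilates the rows of the system but not its right-hand side modulo the extension of `I`. -/
def AdjoinsCertificates {B C : Type*} [CommRing B] [CommRing C] (ι : B →+* C) : Prop :=
  ∀ (I : Ideal B) (k m : ℕ) (g : Fin k → Fin m → B) (s : Fin m → B),
    (∃ c : Fin k → B, ∀ j, s j - ∑ i, c i * g i j ∈ I) ∨
      ∃ ψ : Fin m → C, (∀ i, ∑ j, ι (g i j) * ψ j = 0) ∧ ∑ j, ι (s j) * ψ j ∉ I.map ι

/-- A finitely generated ideal and a finite linear system over the limit are defined over some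
term of the sequence. A solution there is a solution over the limit; otherwise the next term has a
certificate of unsolvability, which remains one over the limit because that term is a retract. -/
theorem SplitLimit.fredholmAlternative {T : ℕ → Type*} [∀ n, CommRing (T n)]
    {p : ∀ n, T (n + 1) →+* T n} {ι : ∀ n, T n →+* T (n + 1)} (hp : ∀ n x, p n (ι n x) = x)
    (hι : ∀ n, AdjoinsCertificates (ι n)) (A : Ideal (SplitLimit p ι)) (hA : A.FG) :
    FredholmAlternative A := by
  intro k m g s
  obtain ⟨l, a, rfl⟩ := Submodule.fg_iff_exists_fin_generating_family.mp hA
  obtain ⟨N, hN⟩ := exists_incl_proj hp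
    (Sum.elim a (Sum.elim s fun q : Fin k × Fin m => g q.1 q.2))
  have ha (i) : incl hp N (proj p ι N (a i)) = a i := hN (.inl i)
  have hs (j) : incl hp N (proj p ι N (s j)) = s j := hN (.inr (.inl j))
  have hg (i j) : incl hp N (proj p ι N (g i j)) = g i j := hN (.inr (.inr (i, j)))
  have ha' (i) : proj p ι (N + 1) (a i) = ι N (proj p ι N (a i)) := by
    rw [← proj_succ_incl hp, ha]
  have hs' (i) : proj p ι (N + 1) (s i) = ι N (proj p ι N (s i)) := by
    rw [← proj_succ_incl hp, hs]
  let I : Ideal (T N) := Ideal.span (Set.range fun i => proj p ι N (a i))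
  rcases hι N I k m (fun i j => proj p ι N (g i j)) (fun j => proj p ι N (s j)) with
    ⟨c, hc⟩ | ⟨ψ, h1, h2⟩
  · refine .inl ⟨fun i => incl hp N (c i), fun j => ?_⟩
    have := Ideal.mem_map_of_mem (incl hp N) (hc j)
    rw [Ideal.map_span, ← Set.range_comp] at this
    simpa [Function.comp_def, ha, hs, hg] using this
  · refine .inr ⟨fun j => incl hp (N + 1) (ψ j), fun i => ?_, fun hmem => h2 ?_⟩
    · convert Ideal.zero_mem _
      have := congrArg (incl hp (N + 1)) (h1 i)
      simpa [incl_succ, hg] using this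
    · have := Ideal.mem_map_of_mem (proj p ι (N + 1)) hmem
      rw [← Ideal.span, Ideal.map_span, ← Set.range_comp] at this
      rw [Ideal.map_span, ← Set.range_comp]
      simpa [Function.comp_def, ha', hs'] using this

/-! ### Adjoining certificates by a trivial extension -/

/-- The product of all quotients of all finite free modules. -/
abbrev AllQuotients (B : Type u) [CommRing B] : Type u :=
  ∀ q : Σ m : ℕ, Submodule B (Fin m → B), (Fin q.1 → B) ⧸ q.2

/-- The trivial square-zero extension of `B` by the product of all quotients of all finite free
modules. -/
abbrev QuotientExt (B : Type u) [CommRing B] : Type u := TrivSqZeroExt B (AllQuotients B)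

/-- The certificate is the tuple of the classes of the standard basis vectors in `B ^ m ⧸ N`, where
`N` is generated by the rows of the system and by `I ^ m`: it sends a vector over `B` to its class,
and `I` annihilates `B ^ m ⧸ N`. -/
theorem adjoinsCertificates_inlHom (B : Type u) [CommRing B] :
    AdjoinsCertificates (B := B) (C := QuotientExt B)
      (TrivSqZeroExt.inlHom B (AllQuotients B)) := by
  classical
  intro I k m g s
  let N : Submodule B (Fin m → B) :=
    Submodule.span B (Set.range g) ⊔ Submodule.pi Set.univ fun _ => I
  let q : Σ m : ℕ, Submodule B (Fin m → B) := ⟨m, N⟩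
  have hI (a : B) (ha : a ∈ I) (y : (Fin m → B) ⧸ N) : a • y = 0 := by
    obtain ⟨v, rfl⟩ := N.mkQ_surjective y
    rw [← map_smul]
    refine (Submodule.Quotient.mk_eq_zero N).mpr (Submodule.mem_sup_right ?_)
    exact Submodule.mem_pi.mpr fun j _ => I.mul_mem_right _ ha
  let θ : (Fin m → B) →ₗ[B] QuotientExt B := TrivSqZeroExt.inrHom B (AllQuotients B) ∘ₗ
    LinearMap.single B (fun q : Σ m : ℕ, Submodule B (Fin m → B) => (Fin q.1 → B) ⧸ q.2) q ∘ₗ N.mkQ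
  let ψ : Fin m → QuotientExt B := fun j => θ (Pi.single j 1)
  have hψ (v : Fin m → B) :
      ∑ j, TrivSqZeroExt.inlHom B (AllQuotients B) (v j) * ψ j = θ v := by
    conv_rhs => rw [pi_eq_sum_univ' v, map_sum]
    refine Finset.sum_congr rfl fun j _ => ?_
    rw [map_smul]
    exact TrivSqZeroExt.inl_mul_eq_smul _ _
  by_cases hs : s ∈ N
  · obtain ⟨y, hy, z, hz, hyz⟩ := Submodule.mem_sup.mp hs
    obtain ⟨c, rfl⟩ := (Submodule.mem_span_range_iff_exists_fun B).mp hy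
    refine .inl ⟨c, fun j => ?_⟩
    have := Submodule.mem_pi.mp hz j trivial
    simpa [← hyz] using this
  · refine .inr ⟨ψ, fun i => ?_, fun hmem => hs ?_⟩
    · rw [hψ]
      have : N.mkQ (g i) = 0 := (Submodule.Quotient.mk_eq_zero N).mpr
        (Submodule.mem_sup_left (Submodule.subset_span ⟨i, rfl⟩))
      simp [θ, this]
    · rw [hψ] at hmem
      -- The second condition survives multiplication because `I` annihilates `B ^ m ⧸ N`.
      have key : ∀ x ∈ I.map (TrivSqZeroExt.inlHom B (AllQuotients B)),
          x.fst ∈ I ∧ x.snd q = 0 := by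
        intro x hx
        induction hx using Submodule.span_induction with
        | mem x hx =>
          obtain ⟨a, ha, rfl⟩ := hx
          exact ⟨ha, rfl⟩
        | zero => exact ⟨I.zero_mem, rfl⟩
        | add x y _ _ hx hy => exact ⟨I.add_mem hx.1 hy.1, by simp [hx.2, hy.2]⟩
        | smul a x _ hx =>
          refine ⟨I.mul_mem_left _ hx.1, ?_⟩
          simp [TrivSqZeroExt.snd_mul, hx.2, hI _ hx.1]
      simpa [θ] using (key _ hmem).2

/-! ### The tower of trivial extensions -/

/-- The sequence of rings obtained from `B` by iterating `QuotientExt`. -/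
noncomputable def quotientTower (B : Type u) [CommRing B] : ℕ → CommRingCat.{u}
  | 0 => .of B
  | n + 1 => .of (QuotientExt (quotientTower B n))

/-- The retractions of the tower. -/
noncomputable def quotientTowerFst (B : Type u) [CommRing B] (n : ℕ) :
    quotientTower B (n + 1) →+* quotientTower B n :=
  (TrivSqZeroExt.fstHom (quotientTower B n) (quotientTower B n)
    (AllQuotients (quotientTower B n))).toRingHom

/-- The inclusions of the tower. -/
noncomputable def quotientTowerInl (B : Type u) [CommRing B] (n : ℕ) :
    quotientTower B n →+* quotientTower B (n + 1) :=
  TrivSqZeroExt.inlHom (quotientTower B n) (AllQuotients (quotientTower B n))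

theorem quotientTowerFst_inl (B : Type u) [CommRing B] (n : ℕ) (x : quotientTower B n) :
    quotientTowerFst B n (quotientTowerInl B n x) = x :=
  TrivSqZeroExt.fst_inl (AllQuotients (quotientTower B n)) x

/-- The limit of the tower, as a ring of threads. -/
abbrev QuotientTowerLimit (B : Type u) [CommRing B] : Type u :=
  SplitLimit (T := fun n => quotientTower B n) (quotientTowerFst B) (quotientTowerInl B)

theorem quotientTower_isUnit_or_isNilpotent {B : Type u} [CommRing B]
    (hB : ∀ x : B, IsUnit x ∨ IsNilpotent x) (n : ℕ) (x : quotientTower B n) :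
    IsUnit x ∨ IsNilpotent x := by
  induction n with
  | zero => exact hB x
  | succ n ih =>
    exact (ih (quotientTowerFst B n x)).imp TrivSqZeroExt.isUnit_iff_isUnit_fst.mpr
      TrivSqZeroExt.isNilpotent_iff_isNilpotent_fst.mpr

/-- The limit of the tower over a ring `B` whose elements are units or nilpotent is a
zero-dimensional finitely fractionally self FP-injective ring. It has `B` as a retract, so that it
inherits incomparable principal ideals from `B`. -/
theorem exists_isFinitelyFractionally_isSelfFPInjective {B : Type u} [CommRing B] [Nontrivial B]
    (hB : ∀ x : B, IsUnit x ∨ IsNilpotent x) {a b : B} (hab : ¬ a ∣ b) (hba : ¬ b ∣ a) :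
    ∃ (R : Type u) (_ : CommRing R),
      ringKrullDim R = 0 ∧ ¬ IsArithmeticalRing R ∧
        IsFinitelyFractionally.{u} (fun S _ => IsSelfFPInjective S) R := by
  have hR : ∀ x : QuotientTowerLimit B, IsUnit x ∨ IsNilpotent x :=
    SplitLimit.isUnit_or_isNilpotent (quotientTowerFst_inl B)
      (quotientTower_isUnit_or_isNilpotent hB)
  have : Nontrivial (quotientTower B 0) := ‹Nontrivial B›
  have : Nontrivial (QuotientTowerLimit B) := SplitLimit.nontrivial 0
  have harith : ¬ IsArithmeticalRing (QuotientTowerLimit B) :=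
    not_isArithmeticalRing hR
      (SplitLimit.not_incl_dvd (quotientTowerFst_inl B) (N := 0) hab)
      (SplitLimit.not_incl_dvd (quotientTowerFst_inl B) (N := 0) hba)
  have hF (A : Ideal (QuotientTowerLimit B)) (hA : A.FG) : FredholmAlternative A :=
    SplitLimit.fredholmAlternative (quotientTowerFst_inl B)
      (fun n => adjoinsCertificates_inlHom (quotientTower B n)) A hA
  exact ⟨QuotientTowerLimit B, inferInstance,
    ringKrullDim_eq_zero_of_isUnit_or_isNilpotent hR, harith,
    isFinitelyFractionally_isSelfFPInjective hR hF⟩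

theorem TrivSqZeroExt.smul_eq_of_inr_dvd_inr {k M : Type*} [CommRing k] [AddCommGroup M]
    [Module k M] [Module kᵐᵒᵖ M] [IsCentralScalar k M] {u v : M}
    (h : (inr u : TrivSqZeroExt k M) ∣ inr v) : ∃ c : k, c • u = v := by
  obtain ⟨c, hc⟩ := h
  exact ⟨c.fst, by simpa using (congrArg snd hc).symm⟩

theorem mainTheorem12 :
    ∃ (R : Type u) (_ : CommRing R),
      ringKrullDim R = 0 ∧ ¬ IsArithmeticalRing R ∧
        IsFinitelyFractionally.{u} (fun S _ => IsSelfFPInjective S) R := by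
  -- The two basis vectors of the square-zero ideal `ℚ × ℚ` do not divide each other.
  refine exists_isFinitelyFractionally_isSelfFPInjective
    (B := TrivSqZeroExt (ULift.{u} ℚ) (ULift.{u} ℚ × ULift.{u} ℚ))
    TrivSqZeroExt.isUnit_or_isNilpotent (a := .inr (1, 0)) (b := .inr (0, 1))
    (fun h => ?_) (fun h => ?_)
  · obtain ⟨c, hc⟩ := TrivSqZeroExt.smul_eq_of_inr_dvd_inr h
    simpa using congrArg Prod.snd hc
  · obtain ⟨c, hc⟩ := TrivSqZeroExt.smul_eq_of_inr_dvd_inr h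
    simpa using congrArg Prod.fst hc
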